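/- Let $p,r\in[0,1]$ and let $\mu$ be a probability measure on $\{0,1\}^{\mathbb Z}$. The law $\mathcal L(\mu;p,r)$ is the law of the random array $(e(i,t): i\in\mathbb Z,\ t\in\mathbb N)\in\{0,1\}^{\mathbb Z\times\mathbb N}$ whose lines $(e(i,t))_{i\in\mathbb Z}$, $t=0,1,2,\dots$, form the following Markov chain on $\{0,1\}^{\mathbb Z}$. * Line $0$, $(e(i,0))_{i\in\mathbb Z}$, has law $\mu$. * For even $t$, given line $t$, the pairs $(e(2i,t+1),e(2i+1,t+1))$, $i\in\mathbb Z$, are independent, and the $i$-th one depends only on $(e(2i,t),e(2i+1,t))$, with the following transition probabilities, for $k\in\{0,1\}$: the pair $(k,k)$ becomes $(k,k)$ with probability $r$ and $(1-k,1-k)$ with probability $1-r$; the pair $(k,1-k)$ becomes $(1-k,k)$ with probability $p$ and $(k,1-k)$ with probability $1-p$. * For odd $t$ the transition is the same, with the pairs of abscissas $(2i-1,2i)$, $i\in\mathbb Z$, instead of $(2i,2i+1)$. Let $\mu_t$ denote the law of line $t$, $(e(i,t))_{i\in\mathbb Z}$, under $\mathcal L(\mu;p,r)$, and let $\mathrm{PM}_{1/2}$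 be the law on $\{0,1\}^{\mathbb Z}$ under which the coordinates are i.i.d. Bernoulli$(1/2)$. **Proposition.** Let $(p,r)\in(0,1)^2$. For every probability measure $\mu$ on $\{0,1\}^{\mathbb Z}$, as $t\to\infty$, $\mu_t$ converges in law (weakly, for the product topology on $\{0,1\}^{\mathbb Z}$) to $\mathrm{PM}_{1/2}$; also in the sense of finite-dimensional distributions: for every finite $S\subset\mathbb Z$ and every $x\in\{0,1\}^{\mathbb Z}$, $$\mu_t\big(\{e : e_i=x_i \text{ for all } i\in S\}\big)\longrightarrow 2^{-|S|}.$$ So the dynamics is ergodic: moreover $\mathrm{PM}_{1/2}$ is invariant (if $\mu=\mathrm{PM}_{1/2}$, then $\mu_t=\mathrm{PM}_{1/2}$ for all $t$), and it is the only invariant law; in fact any probability measure $\nu$ such that the choice $\mu=\nu$ gives $\mu_2=\nu$ is equal to $\mathrm{PM}_{1/2}$. -/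

import Mathlib

open MeasureTheory ProbabilityTheory Filter Topology unitInterval

/-- A line of up/down orientations: `x i = true` (state `1`) means that the edge of abscissa `i`
is up-oriented, `x i = false` (state `0`) that it is down-oriented. -/
abbrev EdgeLine : Type := ℤ → Bool

/-- Local transition law of a pair of neighbouring edges:
`(k, k)` becomes `(k, k)` with probability `r` and `(1-k, 1-k)` with probability `1 - r`;
`(k, 1-k)` becomes `(1-k, k)` with probability `p` and `(k, 1-k)` with probability `1 - p`. -/
noncomputable def pairLaw (p r : I) (x : Bool × Bool) : Measure (Bool × Bool) :=
  if x.1 = x.2 then bernoulliMeasure x (!x.1, !x.2) r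
  else bernoulliMeasure (!x.1, !x.2) x p

instance (p r : I) (x : Bool × Bool) : IsProbabilityMeasure (pairLaw p r x) := by
  unfold pairLaw; split_ifs <;> infer_instance

/-- The `i`-th pair of a line, at abscissas `(2i - s, 2i + 1 - s)`. The shift `s` is `0` for the
pairs `(2i, 2i+1)` and `1` for the pairs `(2i-1, 2i)`. -/
def toPairs (s : ℤ) (x : EdgeLine) : ℤ → Bool × Bool :=
  fun i => (x (2 * i - s), x (2 * i + 1 - s))

/-- The line whose `i`-th pair, at abscissas `(2i - s, 2i + 1 - s)`, is `w i`. -/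
def ofPairs (s : ℤ) (w : ℤ → Bool × Bool) : EdgeLine :=
  fun j => if (j + s) % 2 = 0 then (w ((j + s) / 2)).1 else (w ((j + s) / 2)).2

theorem toPairs_ofPairs (s : ℤ) (w : ℤ → Bool × Bool) : toPairs s (ofPairs s w) = w := by
  funext i
  have h1 : (2 * i - s + s) % 2 = 0 := by omega
  have h2 : (2 * i - s + s) / 2 = i := by omega
  have h3 : ¬ (2 * i + 1 - s + s) % 2 = 0 := by omega
  have h4 : (2 * i + 1 - s + s) / 2 = i := by omega
  simp only [toPairs, ofPairs, h1, h2, h3, h4, if_true, if_false]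

theorem measurable_toPairs (s : ℤ) : Measurable (toPairs s) := by
  unfold toPairs; fun_prop

theorem measurable_ofPairs (s : ℤ) : Measurable (ofPairs s) := by
  refine measurable_pi_lambda _ fun j => ?_
  unfold ofPairs
  split_ifs <;> fun_prop

/-- Given the current line `x`, all pairs are updated independently according to `pairLaw`. -/
noncomputable def pairsLaw (p r : I) (s : ℤ) (x : EdgeLine) : Measure (ℤ → Bool × Bool) :=
  Measure.infinitePi fun i => pairLaw p r (toPairs s x i)

instance (p r : I) (s : ℤ) (x : EdgeLine) : IsProbabilityMeasure (pairsLaw p r s x) := by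
  unfold pairsLaw; infer_instance

theorem measurable_pairsLaw (p r : I) (s : ℤ) : Measurable (pairsLaw p r s) := by
  refine Measurable.measure_of_isPiSystem_of_isProbabilityMeasure
    (generateFrom_squareCylinders (α := fun _ : ℤ => Bool × Bool)).symm
    (isPiSystem_squareCylinders (fun _ => MeasurableSpace.isPiSystem_measurableSet)
      (fun _ => by simp)) ?_
  rintro _ ⟨F, t, ht, rfl⟩
  simp only [Set.mem_univ_pi, Set.mem_ofPred_eq] at ht
  have h : (fun x => pairsLaw p r s x ((F : Set ℤ).pi t))
      = fun x => ∏ i ∈ F, pairLaw p r (toPairs s x i) (t i) := by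
    funext x
    exact Measure.infinitePi_pi _ fun i _ => ht i
  rw [h]
  refine Finset.measurable_prod _ fun i _ => ?_
  exact (measurable_of_countable fun y : Bool × Bool => pairLaw p r y (t i)).comp
    ((measurable_pi_apply i).comp (measurable_toPairs s))

/-- The transition from a line to the next one, with pairs `(2i - s, 2i + 1 - s)`:
the operator `T₀` for `s = 0` and the operator `T₁` for `s = 1`. -/
noncomputable def lineKernel (p r : I) (s : ℤ) : Kernel EdgeLine EdgeLine where
  toFun x := (pairsLaw p r s x).map (ofPairs s)
  measurable' := (Measure.measurable_map _ (measurable_ofPairs s)).comp (measurable_pairsLaw p r s)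

instance (p r : I) (s : ℤ) : IsMarkovKernel (lineKernel p r s) :=
  ⟨fun x => Measure.isProbabilityMeasure_map
    (μ := pairsLaw p r s x) (measurable_ofPairs s).aemeasurable⟩

/-- The transition from lines `0, …, t` to line `t + 1`: it depends on line `t` only, through `T₀`
if `t` is even and `T₁` if `t` is odd. -/
noncomputable def historyKernel (p r : I) (t : ℕ) :
    Kernel (Π _ : Finset.Iic t, EdgeLine) EdgeLine :=
  (lineKernel p r ((t % 2 : ℕ) : ℤ)).comap (fun h => h ⟨t, Finset.mem_Iic.2 le_rfl⟩)
    (measurable_pi_apply _)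

instance (p r : I) (t : ℕ) : IsMarkovKernel (historyKernel p r t) := by
  unfold historyKernel; infer_instance

/-- The law `𝓛(μ; p, r)` of the whole array of orientations `(e t i : t ∈ ℕ, i ∈ ℤ)`: line `0` has
law `μ`, and line `t + 1` is obtained from line `t` by `T₀` or `T₁` according to the parity
of `t`. -/
noncomputable def orientationLaw (μ : ProbabilityMeasure EdgeLine) (p r : I) :
    ProbabilityMeasure (ℕ → EdgeLine) :=
  ⟨Kernel.trajMeasure (X := fun _ : ℕ => EdgeLine) (μ : Measure EdgeLine) (historyKernel p r),
    inferInstance⟩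

/-- The law of line `t` under `𝓛(μ; p, r)`. -/
noncomputable def lineLaw (μ : ProbabilityMeasure EdgeLine) (p r : I) (t : ℕ) :
    ProbabilityMeasure EdgeLine :=
  (orientationLaw μ p r).map (f := fun e : ℕ → EdgeLine => e t) (measurable_pi_apply t).aemeasurable

/-- The product measure on `{0,1}^ℤ` with Bernoulli(`q`) marginals. -/
noncomputable def productBernoulli (q : I) : ProbabilityMeasure EdgeLine :=
  ⟨Measure.infinitePi fun _ : ℤ => bernoulliMeasure true false q, inferInstance⟩

/-- The parameter `1/2`. -/
noncomputable def oneHalf : I := ⟨1 / 2, by norm_num, by norm_num⟩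

/-- `ν` is an invariant law: started from `ν`, every line has law `ν`. -/
def IsInvariantLaw (p r : I) (ν : ProbabilityMeasure EdgeLine) : Prop :=
  ∀ t : ℕ, lineLaw ν p r t = ν

/-! The proof is Fourier analysis on `{0,1}^ℤ`. A move of a pair keeps or flips both spins, so it
preserves their product, and the mean of one new spin is a combination of the two old spins, without
constant term, of coefficient mass `c = |r - p| + |r + p - 1| < 1`. Hence one step sends the
character of a nonempty `A` to a combination of nontrivial characters, of mass at most `c ^ k`,
where `k` is the number of pairs that meet `A` in a single abscissa
(`CharacterBound.abs_integral_bind_le`).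

There is no gain when `A` is a union of pairs, but then the character is exactly preserved. The
maximum of `A` is the left end of its pair for one of the two pairings, so `A` cannot be a union of
pairs for both. Two successive steps therefore multiply the largest nontrivial Fourier coefficient
by at most `c` (`CharacterBound.bind_bind`). All these coefficients tend to `0`, and Fourier
inversion on cylinders gives the limit, the invariance and the uniqueness. -/

/-- The spin `±1` of a state. -/
def spin (b : Bool) : ℝ := if b then 1 else -1

theorem abs_spin (b : Bool) : |spin b| = 1 := by cases b <;> norm_num [spin]

theorem spin_not (b : Bool) : spin (!b) = -spin b := by cases b <;> norm_num [spin]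

/-! ### Characters and uniform bounds on their means -/

/-- The character of `{0,1}^ℤ` indexed by the finite set `A`: the product of the spins in `A`. -/
def character (A : Finset ℤ) (x : EdgeLine) : ℝ := ∏ j ∈ A, spin (x j)

theorem continuous_character (A : Finset ℤ) : Continuous (character A) := by
  unfold character
  exact continuous_finsetProd _ fun j _ =>
    (continuous_of_discreteTopology (f := spin)).comp (continuous_apply j)

theorem abs_character (A : Finset ℤ) (x : EdgeLine) : |character A x| = 1 := by
  simp [character, Finset.abs_prod, abs_spin]

theorem character_union {A B : Finset ℤ} (h : Disjoint A B) (x : EdgeLine) :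
    character (A ∪ B) x = character A x * character B x :=
  Finset.prod_union h

theorem Continuous.integrable_edgeLine {f : EdgeLine → ℝ} (hf : Continuous f)
    (μ : Measure EdgeLine) [IsFiniteMeasure μ] : Integrable f μ :=
  hf.integrable_of_hasCompactSupport (HasCompactSupport.of_compactSpace f)

theorem integral_infinitePi_prod {X : Type*} [MeasurableSpace X] [DiscreteMeasurableSpace X]
    (ν : ℤ → Measure X)
    [∀ i, IsProbabilityMeasure (ν i)] (P : Finset ℤ) (g : ℤ → X → ℝ) :
    ∫ w, ∏ i ∈ P, g i (w i) ∂Measure.infinitePi ν = ∏ i ∈ P, ∫ y, g i y ∂ν i := by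
  have h := integral_restrict_infinitePi (μ := ν) (s := P) (f := fun y => ∏ i : P, g i (y i))
    (Measurable.aestronglyMeasurable (by
      refine Finset.measurable_prod _ fun i _ => ?_
      exact (Measurable.of_discrete (f := g i)).comp (measurable_pi_apply i)))
  rw [integral_fintype_prod_eq_prod (μ := fun i : P => ν i) (fun i : P => g i)] at h
  rw [← Finset.prod_coe_sort P (fun i => ∫ y, g i y ∂ν i), ← h]
  refine integral_congr_ae (ae_of_all _ fun w => ?_)
  exact (Finset.prod_coe_sort P (fun i => g i (w i))).symm

/-- A law with all nontrivial characters of mean at most `M` in absolute value. -/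
def CharacterBound (μ : Measure EdgeLine) (M : ℝ) : Prop :=
  ∀ A : Finset ℤ, A.Nonempty → |∫ x, character A x ∂μ| ≤ M

theorem CharacterBound.nonneg {μ : Measure EdgeLine} {M : ℝ} (h : CharacterBound μ M) : 0 ≤ M :=
  (abs_nonneg _).trans (h {0} (Finset.singleton_nonempty 0))

theorem characterBound_one (μ : Measure EdgeLine) [IsProbabilityMeasure μ] :
    CharacterBound μ 1 := fun A _ => by
  have h := norm_integral_le_of_norm_le_const (μ := μ) (f := character A) (C := 1)
    (ae_of_all _ fun x => (abs_character A x).le)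
  simpa using h

/-- Expanding the product gives only nontrivial characters: `q` keeps the blocks of distinct factors
disjoint, so nothing cancels. The set `D` accumulates the blocks already chosen in the induction. -/
theorem CharacterBound.abs_integral_mul_prod_le {μ : Measure EdgeLine} [IsProbabilityMeasure μ]
    {M : ℝ} (hM : CharacterBound μ M) (q : ℤ → ℤ) (F : ℤ → EdgeLine → ℝ) (c : ℤ → ℝ)
    (P : Finset ℤ)
    (hF : ∀ i ∈ P, ∃ (u v : ℝ) (B C : Finset ℤ), B.Nonempty ∧ C.Nonempty ∧ (∀ j ∈ B, q j = i) ∧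
      (∀ j ∈ C, q j = i) ∧ |u| + |v| ≤ c i ∧ ∀ x, F i x = u * character B x + v * character C x)
    (D : Finset ℤ) (hD : ∀ j ∈ D, q j ∉ P) (hne : D.Nonempty ∨ P.Nonempty) :
    |∫ x, character D x * ∏ i ∈ P, F i x ∂μ| ≤ M * ∏ i ∈ P, c i := by
  induction P using Finset.induction_on generalizing D with
  | empty => simpa using hM D (by simpa using hne)
  | insert i P hi ih =>
    obtain ⟨u, v, B, C, hB, hC, hqB, hqC, huv, hFi⟩ := hF i (Finset.mem_insert_self i P)
    have hF' := fun k (hk : k ∈ P) => hF k (Finset.mem_insert_of_mem hk)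
    have hcont : Continuous fun x => ∏ k ∈ P, F k x := by
      refine continuous_finsetProd _ fun k hk => ?_
      obtain ⟨u, v, B, C, -, -, -, -, -, h⟩ := hF' k hk
      rw [funext h]
      exact (continuous_const.mul (continuous_character B)).add
        (continuous_const.mul (continuous_character C))
    have aux : ∀ E : Finset ℤ, E.Nonempty → (∀ j ∈ E, q j = i) → Disjoint D E ∧
        |∫ x, character (D ∪ E) x * ∏ k ∈ P, F k x ∂μ| ≤ M * ∏ k ∈ P, c k := by
      intro E hE hqE
      refine ⟨Finset.disjoint_left.2 fun j hj hjE => hD j hj ?_, ih hF' _ ?_ ?_⟩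
      · rw [hqE j hjE]; exact Finset.mem_insert_self i P
      · intro j hj hjP
        rcases Finset.mem_union.1 hj with hj | hj
        · exact hD j hj (Finset.mem_insert_of_mem hjP)
        · rw [hqE j hj] at hjP; exact hi hjP
      · exact Or.inl (hE.mono Finset.subset_union_right)
    obtain ⟨dB, iB⟩ := aux B hB hqB
    obtain ⟨dC, iC⟩ := aux C hC hqC
    have hsplit : (fun x => character D x * ∏ k ∈ insert i P, F k x) = fun x =>
        u * (character (D ∪ B) x * ∏ k ∈ P, F k x) +
          v * (character (D ∪ C) x * ∏ k ∈ P, F k x) := by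
      funext x
      rw [Finset.prod_insert hi, hFi, character_union dB, character_union dC]
      ring
    have hint : ∀ E : Finset ℤ, Integrable (fun x => character E x * ∏ k ∈ P, F k x) μ :=
      fun E => ((continuous_character E).mul hcont).integrable_edgeLine μ
    have h0 := (abs_nonneg _).trans iB
    rw [hsplit, integral_add ((hint _).const_mul u) ((hint _).const_mul v), integral_const_mul,
      integral_const_mul, Finset.prod_insert hi]
    calc _ ≤ |u| * (M * ∏ k ∈ P, c k) + |v| * (M * ∏ k ∈ P, c k) := by
          refine (abs_add_le _ _).trans ?_
          rw [abs_mul, abs_mul]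
          gcongr
      _ = (|u| + |v|) * (M * ∏ k ∈ P, c k) := by ring
      _ ≤ c i * (M * ∏ k ∈ P, c k) := by gcongr
      _ = _ := by ring

/-! ### One step of the dynamics -/

theorem integral_pairLaw (p r : I) (x : Bool × Bool) (f : Bool × Bool → ℝ) :
    ∫ y, f y ∂pairLaw p r x =
      if x.1 = x.2 then (r : ℝ) * f x + (1 - r) * f (!x.1, !x.2)
      else (p : ℝ) * f (!x.1, !x.2) + (1 - p) * f x := by
  unfold pairLaw
  split_ifs <;> rw [integral_bernoulliMeasure] <;> simp

theorem integral_pairLaw_mul (p r : I) (x : Bool × Bool) :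
    ∫ y, spin y.1 * spin y.2 ∂pairLaw p r x = spin x.1 * spin x.2 := by
  rw [integral_pairLaw]
  simp only [spin_not]
  split_ifs <;> ring

/-- The mean is `(2r - 1) * spin x.1` on equal pairs and `(1 - 2p) * spin x.1` on unequal ones;
being odd under a global flip, it is linear in the two spins. -/
theorem integral_pairLaw_fst (p r : I) (x : Bool × Bool) :
    ∫ y, spin y.1 ∂pairLaw p r x = (r - p : ℝ) * spin x.1 + (r + p - 1 : ℝ) * spin x.2 := by
  rw [integral_pairLaw]
  obtain ⟨a, b⟩ := x
  cases a <;> cases b <;> simp [spin] <;> ring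

theorem integral_pairLaw_snd (p r : I) (x : Bool × Bool) :
    ∫ y, spin y.2 ∂pairLaw p r x = (r + p - 1 : ℝ) * spin x.1 + (r - p : ℝ) * spin x.2 := by
  rw [integral_pairLaw]
  obtain ⟨a, b⟩ := x
  cases a <;> cases b <;> simp [spin] <;> ring

/-! ### Contraction rate and decomposition of a set into pairs -/

/-- The contraction rate of the dynamics. -/
noncomputable def contractionRate (p r : I) : ℝ := |(r - p : ℝ)| + |(r + p - 1 : ℝ)|

theorem contractionRate_nonneg (p r : I) : 0 ≤ contractionRate p r := by
  unfold contractionRate; positivity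

/-- Since `|a| + |b| = max |a + b| |a - b|`, the rate is `max |2r - 1| |2p - 1|`. -/
theorem contractionRate_lt_one {p r : I} (hp : 0 < p ∧ p < 1) (hr : 0 < r ∧ r < 1) :
    contractionRate p r < 1 := by
  have h1 : (0 : ℝ) < p := hp.1
  have h2 : (p : ℝ) < 1 := hp.2
  have h3 : (0 : ℝ) < r := hr.1
  have h4 : (r : ℝ) < 1 := hr.2
  unfold contractionRate
  rcases abs_cases (r - p : ℝ) with h | h <;> rcases abs_cases (r + p - 1 : ℝ) with h' | h' <;>
    linarith

/-- The abscissas in `A` that belong to the `i`-th pair of shift `s`. -/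
def pairPart (s : ℤ) (A : Finset ℤ) (i : ℤ) : Finset ℤ := A.filter fun j => (j + s) / 2 = i

/-- Both abscissas of the `i`-th pair of shift `s` are in `A`. -/
def FullPair (s : ℤ) (A : Finset ℤ) (i : ℤ) : Prop := 2 * i - s ∈ A ∧ 2 * i + 1 - s ∈ A

/-- The indices of the pairs of shift `s` that meet `A`. -/
def pairIndices (s : ℤ) (A : Finset ℤ) : Finset ℤ := A.image fun j => (j + s) / 2

theorem prod_pairPart (s : ℤ) (A : Finset ℤ) (f : ℤ → ℝ) :
    ∏ i ∈ pairIndices s A, ∏ j ∈ pairPart s A i, f j = ∏ j ∈ A, f j :=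
  Finset.prod_fiberwise_of_maps_to (fun _ hj => Finset.mem_image_of_mem _ hj) f

theorem pairPart_cases (s : ℤ) (A : Finset ℤ) (i : ℤ) (hi : i ∈ pairIndices s A) :
    (FullPair s A i ∧ pairPart s A i = {2 * i - s, 2 * i + 1 - s}) ∨
    (¬ FullPair s A i ∧ pairPart s A i = {2 * i - s}) ∨
    (¬ FullPair s A i ∧ pairPart s A i = {2 * i + 1 - s}) := by
  have key : ∀ j, (j + s) / 2 = i ↔ j = 2 * i - s ∨ j = 2 * i + 1 - s := by intro j; omega
  unfold FullPair
  by_cases h1 : 2 * i - s ∈ A <;> by_cases h2 : 2 * i + 1 - s ∈ A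
  · refine Or.inl ⟨⟨h1, h2⟩, ?_⟩
    ext j
    simp only [pairPart, Finset.mem_filter, key, Finset.mem_insert, Finset.mem_singleton]
    grind
  · refine Or.inr (Or.inl ⟨fun h => h2 h.2, ?_⟩)
    ext j
    simp only [pairPart, Finset.mem_filter, key, Finset.mem_singleton]
    grind
  · refine Or.inr (Or.inr ⟨fun h => h1 h.1, ?_⟩)
    ext j
    simp only [pairPart, Finset.mem_filter, key, Finset.mem_singleton]
    grind
  · obtain ⟨j, hj, hji⟩ := Finset.mem_image.1 hi
    rcases (key j).1 hji with rfl | rfl <;> contradiction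

/-- The mean, after one step from `x`, of the product of the spins in the part of `A` in the `i`-th
pair. -/
noncomputable def pairMean (p r : I) (s : ℤ) (A : Finset ℤ) (i : ℤ) (x : EdgeLine) : ℝ :=
  ∫ y, ∏ j ∈ pairPart s A i, spin (if (j + s) % 2 = 0 then y.1 else y.2)
    ∂pairLaw p r (toPairs s x i)

theorem integral_character_lineKernel (p r : I) (s : ℤ) (A : Finset ℤ) (x : EdgeLine) :
    ∫ y, character A y ∂lineKernel p r s x = ∏ i ∈ pairIndices s A, pairMean p r s A i x := by
  change ∫ y, character A y ∂(pairsLaw p r s x).map (ofPairs s) = _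
  rw [integral_map (measurable_ofPairs s).aemeasurable
    (continuous_character A).aestronglyMeasurable]
  unfold pairMean pairsLaw
  rw [← integral_infinitePi_prod (fun i => pairLaw p r (toPairs s x i)) (pairIndices s A)
    (fun i y => ∏ j ∈ pairPart s A i, spin (if (j + s) % 2 = 0 then y.1 else y.2))]
  refine integral_congr_ae (ae_of_all _ fun w => ?_)
  simp only [character]
  rw [← prod_pairPart s A]
  refine Finset.prod_congr rfl fun i _ => Finset.prod_congr rfl fun j hj => ?_
  have hji : (j + s) / 2 = i := (Finset.mem_filter.1 hj).2
  simp only [ofPairs, hji]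

theorem pairMean_of_fullPair (p r : I) (s : ℤ) (A : Finset ℤ) (i : ℤ)
    (hi : i ∈ pairIndices s A) (h : FullPair s A i) (x : EdgeLine) :
    pairMean p r s A i x = character (pairPart s A i) x := by
  have e1 : (2 * i - s + s) % 2 = 0 := by omega
  have e2 : (2 * i + 1 - s + s) % 2 ≠ 0 := by omega
  have hne : 2 * i - s ≠ 2 * i + 1 - s := by omega
  rcases pairPart_cases s A i hi with ⟨-, h'⟩ | ⟨h', -⟩ | ⟨h', -⟩
  · unfold pairMean character
    simp only [h', Finset.prod_pair hne, if_pos e1, if_neg e2, integral_pairLaw_mul]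
    rfl
  · exact absurd h h'
  · exact absurd h h'

theorem pairMean_of_not_fullPair (p r : I) (s : ℤ) (A : Finset ℤ) (i : ℤ)
    (hi : i ∈ pairIndices s A) (h : ¬ FullPair s A i) :
    ∃ u v : ℝ, |u| + |v| = contractionRate p r ∧ ∀ x, pairMean p r s A i x =
      u * character {2 * i - s} x + v * character {2 * i + 1 - s} x := by
  have e1 : (2 * i - s + s) % 2 = 0 := by omega
  have e2 : (2 * i + 1 - s + s) % 2 ≠ 0 := by omega
  rcases pairPart_cases s A i hi with ⟨h', -⟩ | ⟨-, h'⟩ | ⟨-, h'⟩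
  · exact absurd h' h
  · refine ⟨r - p, r + p - 1, rfl, fun x => ?_⟩
    simp only [pairMean, character, h', Finset.prod_singleton, if_pos e1, integral_pairLaw_fst]
    rfl
  · refine ⟨r + p - 1, r - p, add_comm _ _, fun x => ?_⟩
    simp only [pairMean, character, h', Finset.prod_singleton, if_neg e2, integral_pairLaw_snd]
    rfl

/-! ### Decay of the character means in one and two steps -/

theorem integral_character_bind (p r : I) (s : ℤ) (μ : Measure EdgeLine) [IsProbabilityMeasure μ]
    (A : Finset ℤ) :
    ∫ y, character A y ∂μ.bind (lineKernel p r s) =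
      ∫ x, ∏ i ∈ pairIndices s A, pairMean p r s A i x ∂μ := by
  rw [Measure.comp_eq_comp_const_apply, Kernel.integral_comp
    ((continuous_character A).integrable_edgeLine _), Kernel.const_apply]
  simp only [integral_character_lineKernel]

theorem integral_character_bind_of_full (p r : I) (s : ℤ) (μ : Measure EdgeLine)
    [IsProbabilityMeasure μ] (A : Finset ℤ) (h : ∀ i ∈ pairIndices s A, FullPair s A i) :
    ∫ y, character A y ∂μ.bind (lineKernel p r s) = ∫ x, character A x ∂μ := by
  rw [integral_character_bind]
  refine integral_congr_ae (ae_of_all _ fun x => ?_)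
  simp only
  rw [Finset.prod_congr rfl fun i hi => pairMean_of_fullPair p r s A i hi (h i hi) x]
  exact prod_pairPart s A fun j => spin (x j)

open Classical in
theorem CharacterBound.abs_integral_bind_le {μ : Measure EdgeLine} [IsProbabilityMeasure μ] {M : ℝ}
    (hM : CharacterBound μ M) (p r : I) (s : ℤ) {A : Finset ℤ} (hA : A.Nonempty) :
    |∫ y, character A y ∂μ.bind (lineKernel p r s)| ≤
      M * ∏ i ∈ pairIndices s A, if FullPair s A i then 1 else contractionRate p r := by
  have h := hM.abs_integral_mul_prod_le (fun j => (j + s) / 2) (pairMean p r s A)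
    (fun i => if FullPair s A i then 1 else contractionRate p r) (pairIndices s A) ?_ ∅ (by simp)
    (Or.inr (hA.image _))
  · rw [integral_character_bind]
    simpa [character] using h
  intro i hi
  by_cases hf : FullPair s A i
  · have hpart : (pairPart s A i).Nonempty := by
      obtain ⟨j, hj, hji⟩ := Finset.mem_image.1 hi
      exact ⟨j, Finset.mem_filter.2 ⟨hj, hji⟩⟩
    -- The second character has coefficient `0`; it repeats the first only because its block must be
    -- nonempty.
    refine ⟨1, 0, _, _, hpart, hpart, fun j hj => (Finset.mem_filter.1 hj).2,
      fun j hj => (Finset.mem_filter.1 hj).2, by simp [hf], fun x => ?_⟩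
    rw [pairMean_of_fullPair p r s A i hi hf]
    ring
  · obtain ⟨u, v, huv, hx⟩ := pairMean_of_not_fullPair p r s A i hi hf
    refine ⟨u, v, _, _, Finset.singleton_nonempty _, Finset.singleton_nonempty _, ?_, ?_,
      by simp [hf, huv], hx⟩
    · simp only [Finset.mem_singleton, forall_eq]; omega
    · simp only [Finset.mem_singleton, forall_eq]; omega

theorem CharacterBound.bind {μ : Measure EdgeLine} [IsProbabilityMeasure μ] {M : ℝ}
    (hM : CharacterBound μ M) {p r : I} (hc : contractionRate p r ≤ 1) (s : ℤ) :
    CharacterBound (μ.bind (lineKernel p r s)) M := by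
  classical
  intro A hA
  refine (hM.abs_integral_bind_le p r s hA).trans (mul_le_of_le_one_right hM.nonneg ?_)
  refine Finset.prod_le_one (fun i _ => ?_) fun i _ => ?_ <;> split_ifs
  exacts [zero_le_one, contractionRate_nonneg p r, le_rfl, hc]

theorem CharacterBound.abs_integral_bind_le_of_not_full {μ : Measure EdgeLine}
    [IsProbabilityMeasure μ] {M : ℝ} (hM : CharacterBound μ M) {p r : I}
    (hc : contractionRate p r ≤ 1) (s : ℤ) {A : Finset ℤ} {i : ℤ} (hi : i ∈ pairIndices s A)
    (h : ¬ FullPair s A i) :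
    |∫ y, character A y ∂μ.bind (lineKernel p r s)| ≤ contractionRate p r * M := by
  classical
  have hA : A.Nonempty := Finset.image_nonempty.1 ⟨i, hi⟩
  refine (hM.abs_integral_bind_le p r s hA).trans ?_
  rw [mul_comm, ← Finset.mul_prod_erase _ _ hi, if_neg h]
  refine mul_le_mul_of_nonneg_right
    (mul_le_of_le_one_right (contractionRate_nonneg p r) ?_) hM.nonneg
  refine Finset.prod_le_one (fun i _ => ?_) fun i _ => ?_ <;> split_ifs
  exacts [zero_le_one, contractionRate_nonneg p r, le_rfl, hc]

/-- The parity condition makes the maximum the left end of its pair, so its partner lies beyond `A`.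
-/
theorem exists_not_fullPair {A : Finset ℤ} (hA : A.Nonempty) {s : ℤ}
    (hs : (A.max' hA + s) % 2 = 0) : ∃ i ∈ pairIndices s A, ¬ FullPair s A i := by
  refine ⟨(A.max' hA + s) / 2, Finset.mem_image_of_mem _ (A.max'_mem hA), fun h => ?_⟩
  have := A.le_max' _ h.2
  omega

theorem CharacterBound.bind_bind {μ : Measure EdgeLine} [IsProbabilityMeasure μ] {M : ℝ}
    (hM : CharacterBound μ M) {p r : I} (hc : contractionRate p r ≤ 1) {s s' : ℤ}
    (hs : (s + s') % 2 = 1) :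
    CharacterBound ((μ.bind (lineKernel p r s)).bind (lineKernel p r s'))
      (contractionRate p r * M) := by
  intro A hA
  by_cases hfull : ∀ i ∈ pairIndices s' A, FullPair s' A i
  -- The second step leaves this character unchanged, so the gain must come from the first, whose
  -- pairing splits the maximum of `A` from its partner.
  · rw [integral_character_bind_of_full p r s' _ A hfull]
    rcases Int.emod_two_eq_zero_or_one (A.max' hA + s) with h | h
    · obtain ⟨i, hi, hi'⟩ := exists_not_fullPair hA h
      exact hM.abs_integral_bind_le_of_not_full hc s hi hi'
    · obtain ⟨i, hi, hi'⟩ := exists_not_fullPair hA (s := s') (by omega)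
      exact absurd (hfull i hi) hi'
  · push Not at hfull
    obtain ⟨i, hi, hi'⟩ := hfull
    exact (hM.bind hc s).abs_integral_bind_le_of_not_full hc s' hi hi'

/-! ### The laws of the lines -/

theorem lineLaw_zero (μ : ProbabilityMeasure EdgeLine) (p r : I) : lineLaw μ p r 0 = μ := by
  apply Subtype.ext
  change (Kernel.trajMeasure (X := fun _ : ℕ => EdgeLine) (μ : Measure EdgeLine)
    (historyKernel p r)).map (fun e => e 0) = μ
  have h : (fun e : ℕ → EdgeLine => e 0) =
      (fun h : Π _ : Finset.Iic 0, EdgeLine => h ⟨0, by simp⟩) ∘ Preorder.frestrictLe 0 := rfl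
  rw [h, ← Measure.map_map (by fun_prop) (by fun_prop), Kernel.trajMeasure,
    Measure.map_comp _ _ (by fun_prop), Kernel.traj_map_frestrictLe, Kernel.partialTraj_self,
    Measure.id_comp, Measure.map_map (by fun_prop) (by fun_prop)]
  exact Measure.map_id

theorem lineLaw_succ (μ : ProbabilityMeasure EdgeLine) (p r : I) (t : ℕ) :
    (lineLaw μ p r (t + 1) : Measure EdgeLine) =
      (lineLaw μ p r t : Measure EdgeLine).bind (lineKernel p r ((t % 2 : ℕ) : ℤ)) := by
  set T := Kernel.trajMeasure (X := fun _ : ℕ => EdgeLine) (μ : Measure EdgeLine)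
    (historyKernel p r) with hT
  change T.map (fun e => e (t + 1)) = (T.map (fun e => e t)).bind _
  -- The second marginal of the joint law of the history and the next line; the kernel reads only
  -- line `t` of the history.
  have h := congrArg Measure.snd (Kernel.map_frestrictLe_trajMeasure_compProd_eq_map_trajMeasure
    (X := fun _ : ℕ => EdgeLine) (μ₀ := (μ : Measure EdgeLine)) (κ := historyKernel p r) (a := t))
  rw [Measure.snd_compProd, Measure.snd_map_prodMk (by fun_prop), ← hT] at h
  rw [← h]
  have h' : (fun e : ℕ → EdgeLine => e t) =
      (fun h : Π _ : Finset.Iic t, EdgeLine => h ⟨t, by simp⟩) ∘ Preorder.frestrictLe t := rfl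
  rw [h', ← Measure.map_map (by fun_prop) (by fun_prop)]
  ext A hA
  rw [Measure.bind_apply hA (Kernel.aemeasurable _), Measure.bind_apply hA (Kernel.aemeasurable _)]
  exact (lintegral_map (g := fun h : Π _ : Finset.Iic t, EdgeLine => h ⟨t, by simp⟩)
    (Kernel.measurable_coe (lineKernel p r ((t % 2 : ℕ) : ℤ)) hA) (by fun_prop)).symm

theorem CharacterBound.lineLaw_add_two {μ : ProbabilityMeasure EdgeLine} {p r : I} {t : ℕ} {M : ℝ}
    (hM : CharacterBound (lineLaw μ p r t : Measure EdgeLine) M) (hc : contractionRate p r ≤ 1) :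
    CharacterBound (lineLaw μ p r (t + 2) : Measure EdgeLine) (contractionRate p r * M) := by
  rw [lineLaw_succ, lineLaw_succ]
  exact hM.bind_bind hc (by omega)

theorem characterBound_lineLaw (μ : ProbabilityMeasure EdgeLine) {p r : I}
    (hc : contractionRate p r ≤ 1) (t : ℕ) :
    CharacterBound (lineLaw μ p r t : Measure EdgeLine) (contractionRate p r ^ (t / 2)) := by
  induction t using Nat.twoStepInduction with
  | zero => simpa using characterBound_one _
  -- Odd times start from the trivial bound, since `1 / 2 = 0` in `ℕ`.
  | one => simpa using characterBound_one _
  | more t ih _ =>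
    have h := ih.lineLaw_add_two hc
    rwa [← pow_succ', show t / 2 + 1 = (t + 2) / 2 by omega] at h

theorem tendsto_integral_character_lineLaw (μ : ProbabilityMeasure EdgeLine) {p r : I}
    (hc : contractionRate p r < 1) {A : Finset ℤ} (hA : A.Nonempty) :
    Tendsto (fun t => ∫ x, character A x ∂(lineLaw μ p r t : Measure EdgeLine)) atTop (𝓝 0) := by
  refine squeeze_zero_norm (fun t => characterBound_lineLaw μ hc.le t A hA) ?_
  exact (tendsto_pow_atTop_nhds_zero_of_lt_one (contractionRate_nonneg p r) hc).comp
    (Nat.tendsto_div_const_atTop two_ne_zero)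

/-! ### Characters and cylinders -/

/-- Each constraint has indicator `(1 + spin (x i) * spin (e i)) / 2`; the product over `S` expands
over subsets. -/
theorem indicator_cylinder (S : Finset ℤ) (x e : EdgeLine) :
    {e : EdgeLine | ∀ i ∈ S, e i = x i}.indicator (1 : EdgeLine → ℝ) e =
      (1 / 2 : ℝ) ^ S.card * ∑ A ∈ S.powerset, character A x * character A e := by
  have h1 : ∀ i, (if e i = x i then (1 : ℝ) else 0) = 1 / 2 * (1 + spin (x i) * spin (e i)) := by
    intro i
    cases e i <;> cases x i <;> norm_num [spin]
  have h2 : {e : EdgeLine | ∀ i ∈ S, e i = x i}.indicator (1 : EdgeLine → ℝ) e =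
      ∏ i ∈ S, if e i = x i then (1 : ℝ) else 0 := by
    rw [Finset.prod_ite_zero]
    simp [Set.indicator_apply]
  rw [h2, Finset.prod_congr rfl fun i _ => h1 i, Finset.prod_mul_distrib, Finset.prod_const,
    Finset.prod_one_add]
  simp only [character, Finset.prod_mul_distrib]

theorem isClopen_cylinder (S : Finset ℤ) (x : EdgeLine) :
    IsClopen {e : EdgeLine | ∀ i ∈ S, e i = x i} := by
  have h : {e : EdgeLine | ∀ i ∈ S, e i = x i} = ⋂ i ∈ S, (fun e : EdgeLine => e i) ⁻¹' {x i} := by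
    ext e; simp
  rw [h]
  exact isClopen_biInter_finset fun i _ => (isClopen_discrete {x i}).preimage (continuous_apply i)

theorem measureReal_cylinder (μ : Measure EdgeLine) [IsProbabilityMeasure μ] (S : Finset ℤ)
    (x : EdgeLine) : μ.real {e | ∀ i ∈ S, e i = x i} =
      (1 / 2 : ℝ) ^ S.card * ∑ A ∈ S.powerset, character A x * ∫ e, character A e ∂μ := by
  rw [← integral_indicator_one (isClopen_cylinder S x).isOpen.measurableSet,
    integral_congr_ae (ae_of_all _ (indicator_cylinder S x)), integral_const_mul,
    integral_finsetSum]
  · simp only [integral_const_mul]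
  · exact fun A _ => ((continuous_character A).integrable_edgeLine μ).const_mul _

theorem tendsto_measureReal_cylinder {ι : Type*} {l : Filter ι} {μ : ι → ProbabilityMeasure EdgeLine}
    (h : ∀ A : Finset ℤ, A.Nonempty →
      Tendsto (fun t => ∫ e, character A e ∂(μ t : Measure EdgeLine)) l (𝓝 0))
    (S : Finset ℤ) (x : EdgeLine) :
    Tendsto (fun t => (μ t : Measure EdgeLine).real {e | ∀ i ∈ S, e i = x i}) l
      (𝓝 ((1 / 2 : ℝ) ^ S.card)) := by
  simp only [measureReal_cylinder]
  have hlim : (1 / 2 : ℝ) ^ S.card = (1 / 2 : ℝ) ^ S.card *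
      ∑ A ∈ S.powerset, character A x * if A = ∅ then 1 else 0 := by
    simp [character]
  rw [congrArg 𝓝 hlim]
  refine Tendsto.const_mul ((1 / 2 : ℝ) ^ S.card) ?_
  refine tendsto_finsetSum S.powerset fun A _ => ?_
  refine Tendsto.const_mul (character A x) ?_
  split_ifs with hA
  · subst hA
    simpa [character] using tendsto_const_nhds
  · exact h A (Finset.nonempty_iff_ne_empty.2 hA)

theorem integral_character_productBernoulli {A : Finset ℤ} (hA : A.Nonempty) :
    ∫ e, character A e ∂(productBernoulli oneHalf : Measure EdgeLine) = 0 := by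
  change ∫ e, ∏ i ∈ A, spin (e i) ∂Measure.infinitePi (fun _ : ℤ => bernoulliMeasure true false
    oneHalf) = 0
  rw [integral_infinitePi_prod _ A fun _ => spin]
  obtain ⟨i, hi⟩ := hA
  refine Finset.prod_eq_zero hi ?_
  rw [integral_bernoulliMeasure]
  norm_num [spin, oneHalf]

theorem measureReal_cylinder_productBernoulli (S : Finset ℤ) (x : EdgeLine) :
    (productBernoulli oneHalf : Measure EdgeLine).real {e | ∀ i ∈ S, e i = x i} =
      (1 / 2 : ℝ) ^ S.card := by
  refine tendsto_nhds_unique (l := (atTop : Filter ℕ)) tendsto_const_nhds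
    (tendsto_measureReal_cylinder (μ := fun _ => productBernoulli oneHalf) (fun A hA => ?_) S x)
  rw [integral_character_productBernoulli hA]
  exact tendsto_const_nhds

/-! ### Weak convergence, invariance and uniqueness -/

theorem tendsto_productBernoulli {ι : Type*} {l : Filter ι} [l.IsCountablyGenerated]
    {μ : ι → ProbabilityMeasure EdgeLine}
    (h : ∀ A : Finset ℤ, A.Nonempty →
      Tendsto (fun t => ∫ e, character A e ∂(μ t : Measure EdgeLine)) l (𝓝 0)) :
    Tendsto μ l (𝓝 (productBernoulli oneHalf)) := by
  have hpi : IsPiSystem {s : Set EdgeLine | ∃ (S : Finset ℤ) (x : EdgeLine),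
      s = {e | ∀ i ∈ S, e i = x i}} := by
    -- A common point `y` of two cylinders serves as the base point of their intersection.
    rintro _ ⟨S, x, rfl⟩ _ ⟨S', x', rfl⟩ ⟨y, hy, hy'⟩
    refine ⟨S ∪ S', y, Set.ext fun e => ?_⟩
    simp only [Set.mem_inter_iff, Set.mem_ofPred_eq, Finset.mem_union] at hy hy' ⊢
    grind
  refine hpi.tendsto_probabilityMeasure_of_tendsto_of_mem ?_ ?_ ?_
  · rintro _ ⟨S, x, rfl⟩
    exact (isClopen_cylinder S x).isOpen.measurableSet
  · intro u hu x hx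
    obtain ⟨S, v, hv, hvu⟩ := isOpen_pi_iff.1 hu x hx
    refine ⟨_, ⟨S, x, rfl⟩, (isClopen_cylinder S x).isOpen.mem_nhds fun _ _ => rfl, fun e he => ?_⟩
    refine hvu fun i hi => ?_
    rw [he i hi]
    exact (hv i hi).2
  · rintro _ ⟨S, x, rfl⟩
    rw [← NNReal.tendsto_coe]
    have h1 := tendsto_measureReal_cylinder h S x
    rw [← measureReal_cylinder_productBernoulli S x] at h1
    exact h1

/-- The constant sequence `ν` converges to the product measure, and weak limits are unique. -/
theorem CharacterBound.eq_productBernoulli {ν : ProbabilityMeasure EdgeLine}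
    (h : CharacterBound (ν : Measure EdgeLine) 0) : ν = productBernoulli oneHalf := by
  refine tendsto_nhds_unique (l := (atTop : Filter ℕ)) (f := fun _ => ν) tendsto_const_nhds
    (tendsto_productBernoulli fun A hA => ?_)
  rw [abs_nonpos_iff.1 (h A hA)]
  exact tendsto_const_nhds

theorem isInvariantLaw_productBernoulli {p r : I} (hc : contractionRate p r ≤ 1) :
    IsInvariantLaw p r (productBernoulli oneHalf) := by
  intro t
  induction t with
  | zero => exact lineLaw_zero _ p r
  | succ t ih =>
    refine CharacterBound.eq_productBernoulli ?_
    rw [lineLaw_succ, ih]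
    refine CharacterBound.bind (fun A hA => ?_) hc _
    rw [integral_character_productBernoulli hA, abs_zero]

theorem eq_productBernoulli_of_lineLaw_two {p r : I} (hc : contractionRate p r < 1)
    {ν : ProbabilityMeasure EdgeLine} (h : lineLaw ν p r 2 = ν) :
    ν = productBernoulli oneHalf := by
  have hb : ∀ n : ℕ, CharacterBound (ν : Measure EdgeLine) (contractionRate p r ^ n) := by
    intro n
    induction n with
    | zero => simpa using characterBound_one _
    | succ n ih =>
      have h0 : CharacterBound (lineLaw ν p r 0 : Measure EdgeLine) (contractionRate p r ^ n) := by
        rwa [lineLaw_zero]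
      have h2 := h0.lineLaw_add_two hc.le
      -- Periodicity turns the improved bound at time `2` into a bound on `ν` itself, which can be
      -- iterated.
      rwa [zero_add, h, ← pow_succ'] at h2
  exact CharacterBound.eq_productBernoulli fun A hA => ge_of_tendsto'
    (tendsto_pow_atTop_nhds_zero_of_lt_one (contractionRate_nonneg p r) hc) fun n => hb n A hA

theorem mainTheorem5 (p r : I) (hp : 0 < p ∧ p < 1) (hr : 0 < r ∧ r < 1) :
    -- from every initial law, the law of line `t` converges weakly to the product measure
    (∀ μ : ProbabilityMeasure EdgeLine,
      Tendsto (fun t : ℕ => lineLaw μ p r t) atTop (𝓝 (productBernoulli oneHalf))) ∧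
    -- and so do all finite-dimensional distributions
    (∀ (μ : ProbabilityMeasure EdgeLine) (S : Finset ℤ) (x : ℤ → Bool),
      Tendsto (fun t : ℕ => (lineLaw μ p r t : Measure EdgeLine).real {e | ∀ i ∈ S, e i = x i})
        atTop (𝓝 ((1 / 2 : ℝ) ^ S.card))) ∧
    -- ergodicity: the product measure is invariant, and it is the only law that is preserved
    -- by one full period (one step of each of the two operators)
    IsInvariantLaw p r (productBernoulli oneHalf) ∧
    (∀ ν : ProbabilityMeasure EdgeLine, lineLaw ν p r 2 = ν → ν = productBernoulli oneHalf) := by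
  have hc := contractionRate_lt_one hp hr
  exact ⟨fun μ => tendsto_productBernoulli fun A hA => tendsto_integral_character_lineLaw μ hc hA,
    fun μ S x => tendsto_measureReal_cylinder
      (fun A hA => tendsto_integral_character_lineLaw μ hc hA) S x,
    isInvariantLaw_productBernoulli hc.le,
    fun ν hν => eq_productBernoulli_of_lineLaw_two hc hν⟩
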